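/- Let $N_{\mathbb R}$ be a finite-dimensional real vector space with an inner product (write $n=\dim N_{\mathbb R}$), and let $\Sigma$ be a complete simplicial fan in $N_{\mathbb R}$ with set of rays $\Sigma(1)$ and a chosen generator $v_\rho$ of each ray $\rho$. (Rationality of the cones is not needed.) For a cone $\sigma\in\Sigma$ let $\sigma(1)$ be its set of rays, $\mathbb R\sigma$ its linear span, $(N/\sigma)_{\mathbb R}=N_{\mathbb R}/\mathbb R\sigma$, and $q_\sigma$ the quotient map. For $\rho\in\Sigma(1)$ let $h^\rho\colon N_{\mathbb R}\to\mathbb R_{\ge 0}$ be the piecewise linear function which, on a cone $\sigma$ with $\rho\in\sigma(1)$, is the $v_\rho$-coordinate in the basis $(v_{\rho'})_{\rho'\in\sigma(1)}$ of $\mathbb R\sigma$, and which vanishes on the cones not containing $\rho$. *Smoothing data.* Let $\chi\colon N_{\mathbb R}\to\mathbb R_{\ge0}$ be a $C^\infty$, radially symmetric function supported in the closed unit ball with $\int\chi=1$, let $\varepsilon,\delta>0$, $\chi_\delta(x)=\delta^{-n}\chi(x/\delta)$ and $h^\rho_\delta=h^\rho*\chi_\delta$. Let $r_\varepsilon\colon\mathbb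 R\to\mathbb R$ be $C^\infty$ and non-decreasing, non-zero exactly on $(\varepsilon,\infty)$, with $r_\varepsilon(x)=x-\varepsilon$ for $x>2\varepsilon$ and $|r_\varepsilon(x)-(x-\varepsilon)|\le\varepsilon^2$ for $x\in(\varepsilon,2\varepsilon)$. Let $\widetilde\Phi^t_\rho$ be the flow of the vector field $\widetilde V_\rho(x)=r_\varepsilon(h^\rho_\delta(x))\,v_\rho$. The smoothed total scaling action $\widetilde A_{\mathrm{tot}}$ lets $t\in\mathbb R^{\Sigma(1)}$ act on $N_{\mathbb R}$ by the composition of the maps $\widetilde\Phi^{t(\rho)}_\rho$, $\rho\in\Sigma(1)$. For $\sigma\in\Sigma$ put $$\mathrm{st}^{fr}(\sigma)=\{x\in N_{\mathbb R}: h^\rho_\delta(x)>\varepsilon\ \text{for all}\ \rho\in\sigma(1)\},\qquad \sigma^{fr}=\mathrm{st}^{fr}(\sigma)\cap\mathrm{relint}(\sigma).$$ **Statement.** There is a constant $c>0$, depending only on $\Sigma$, the generators $v_\rho$ and the inner product, such that for all $\varepsilon>0$, all $0<\delta\le c\,\varepsilon$ and all $\chi$, $r_\varepsilon$ as above, the flows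 $\widetilde\Phi^t_\rho$ exist for all $t\in\mathbb R$ and commute with each other, so that $\widetilde A_{\mathrm{tot}}$ is a well-defined action of $\mathbb R^{\Sigma(1)}$, and there is a collection of smooth maps $\pi_\sigma\colon\mathrm{st}^{fr}(\sigma)\to\sigma^{fr}$, indexed by the non-zero cones $\sigma\in\Sigma$, such that: 1. for every $b\in\sigma^{fr}$, the fibre $\pi_\sigma^{-1}(b)$ projects diffeomorphically onto $(N/\sigma)_{\mathbb R}$ under $q_\sigma$; 2. for all non-zero cones $\sigma\subseteq\tau$ of $\Sigma$ one has $\mathrm{st}^{fr}(\tau)\subseteq\mathrm{st}^{fr}(\sigma)$ and $\pi_\sigma\circ\pi_\tau=\pi_\sigma|_{\mathrm{st}^{fr}(\tau)}$; 3. the subgroup $\mathbb R^{\sigma(1)}\subseteq\mathbb R^{\Sigma(1)}$ preserves $\mathrm{st}^{fr}(\sigma)$ and $\sigma^{fr}$ under $\widetilde A_{\mathrm{tot}}$, and $\pi_\sigma$ is $\mathbb R^{\sigma(1)}$-equivariant. -/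

import Mathlib

open scoped ContDiff

/-- A complete simplicial fan in the real vector space `E`, together with a chosen generator
`v ρ` of each of its rays.  The rays are indexed by the finite type `ι`; a cone of the fan is recorded
by the finite set of rays that span it, and `cones` is the set of all cones of the fan. -/
structure CompleteSimplicialFan (ι E : Type*) [Fintype ι] [DecidableEq ι]
    [AddCommGroup E] [Module ℝ E] where
  /-- the chosen ray generators -/
  v : ι → E
  /-- the cones of the fan, each given by its set of rays -/
  cones : Set (Finset ι)
  /-- the zero cone belongs to the fan -/
  empty_mem : ∅ ∈ cones
  /-- every `ρ : ι` is a ray of the fan -/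
  ray_mem : ∀ ρ, {ρ} ∈ cones
  /-- the fan is closed under passing to faces -/
  face_mem : ∀ σ ∈ cones, ∀ τ ⊆ σ, τ ∈ cones
  /-- every cone of the fan is simplicial -/
  linearIndep : ∀ σ ∈ cones, LinearIndepOn ℝ v (σ : Set ι)
  /-- two cones of the fan intersect in the common face spanned by their common rays -/
  inter_cone : ∀ σ ∈ cones, ∀ τ ∈ cones,
    {x | ∃ a : ι → ℝ, (∀ ρ ∈ σ, 0 ≤ a ρ) ∧ x = ∑ ρ ∈ σ, a ρ • v ρ} ∩
      {x | ∃ a : ι → ℝ, (∀ ρ ∈ τ, 0 ≤ a ρ) ∧ x = ∑ ρ ∈ τ, a ρ • v ρ} =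
      {x | ∃ a : ι → ℝ, (∀ ρ ∈ σ ∩ τ, 0 ≤ a ρ) ∧ x = ∑ ρ ∈ σ ∩ τ, a ρ • v ρ}
  /-- the fan is complete: its cones cover the whole space -/
  complete : ∀ x : E, ∃ σ ∈ cones, ∃ a : ι → ℝ, (∀ ρ ∈ σ, 0 ≤ a ρ) ∧ x = ∑ ρ ∈ σ, a ρ • v ρ

/-- `Φ` is the flow of the vector field `V`, defined for all times. -/
def IsGlobalFlow {E : Type*} [NormedAddCommGroup E] [NormedSpace ℝ E]
    (V : E → E) (Φ : ℝ → E → E) : Prop :=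
  ∀ x, Φ 0 x = x ∧ ∀ t, HasDerivAt (fun s => Φ s x) (V (Φ t x)) t

open Classical in
/-- The flow of a complete vector field (the constant flow if there is no global flow). -/
noncomputable def globalFlow {E : Type*} [NormedAddCommGroup E] [NormedSpace ℝ E]
    (V : E → E) : ℝ → E → E :=
  if h : ∃ Φ, IsGlobalFlow V Φ then h.choose else fun _ x => x

/-- `χ` is a smooth non-negative radially symmetric function, supported on the closed unit ball and
of integral `1`. -/
structure IsRadialBump {E : Type*} [NormedAddCommGroup E] [InnerProductSpace ℝ E]
    [FiniteDimensional ℝ E] [MeasurableSpace E] [BorelSpace E] (χ : E → ℝ) : Prop where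
  contDiff : ContDiff ℝ ∞ χ
  nonneg : ∀ x, 0 ≤ χ x
  radial : ∀ x y, ‖x‖ = ‖y‖ → χ x = χ y
  support_subset : Function.support χ ⊆ Metric.closedBall 0 1
  integral_eq_one : ∫ x, χ x = 1

/-- The rescaled bump function `χ_δ(x) = δ⁻ⁿ χ(x / δ)`, `n = dim E`. -/
noncomputable def scaledBump {E : Type*} [NormedAddCommGroup E] [InnerProductSpace ℝ E]
    (χ : E → ℝ) (δ : ℝ) (x : E) : ℝ :=
  (δ ^ Module.finrank ℝ E)⁻¹ * χ (δ⁻¹ • x)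

/-- `r` is a smoothing of `x ↦ max (x - ε) 0`: smooth, non-decreasing, non-zero exactly on `(ε, ∞)`,
equal to `x - ε` for `x > 2ε` and `ε²`-close to it on `(ε, 2ε)`. -/
structure IsSmoothedRamp (ε : ℝ) (r : ℝ → ℝ) : Prop where
  contDiff : ContDiff ℝ ∞ r
  monotone : Monotone r
  support_eq : Function.support r = Set.Ioi ε
  eq_of_gt : ∀ x, 2 * ε < x → r x = x - ε
  close : ∀ x ∈ Set.Ioo ε (2 * ε), |r x - (x - ε)| ≤ ε ^ 2

/-- The subset `A` of `E` projects diffeomorphically onto `E ⧸ W` under the (linear, hence smooth)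
quotient map: the restriction of the quotient map to `A` is a bijection onto `E ⧸ W` whose inverse
`s` is smooth as a map into `E`.  (In particular `A` is then a closed embedded submanifold of `E`.) -/
def ProjectsDiffeomorphically {E : Type*} [NormedAddCommGroup E] [InnerProductSpace ℝ E]
    (W : Submodule ℝ E) [IsClosed (W : Set E)] (A : Set E) : Prop :=
  ∃ s : E ⧸ W → E, ContDiff ℝ ∞ s ∧ (∀ y, s y ∈ A) ∧ (∀ y, W.mkQ (s y) = y) ∧
    ∀ x ∈ A, s (W.mkQ x) = x

/-- Composition of the maps `Φ ρ (t ρ)` over all `ρ : ι`.  It is applied to commuting families, so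
that the chosen order of the composition does not matter. -/
noncomputable def composeAll {ι E : Type*} [Fintype ι] (Φ : ι → ℝ → E → E) (t : ι → ℝ) : E → E :=
  ((Finset.univ : Finset ι).toList.map fun ρ => Φ ρ (t ρ)).foldr (fun f g => f ∘ g) id

namespace CompleteSimplicialFan

section Linear

variable {ι E : Type*} [Fintype ι] [DecidableEq ι] [AddCommGroup E] [Module ℝ E]
  (F : CompleteSimplicialFan ι E)

/-- The relative interior of the simplicial cone `σ`: all combinations of its ray generators with
positive coefficients. -/
def relint (σ : Finset ι) : Set E :=
  {x | ∃ a : ι → ℝ, (∀ ρ ∈ σ, 0 < a ρ) ∧ x = ∑ ρ ∈ σ, a ρ • F.v ρ}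

/-- The linear span `ℝσ` of the cone `σ`. -/
def linearSpan (σ : Finset ι) : Submodule ℝ E :=
  Submodule.span ℝ (F.v '' (σ : Set ι))

theorem exists_coords (u : E) : ∃ a : ι → ℝ, (∀ ρ, 0 ≤ a ρ) ∧
    (∃ σ ∈ F.cones, ∀ ρ ∉ σ, a ρ = 0) ∧ u = ∑ ρ, a ρ • F.v ρ := by
  obtain ⟨σ, hσ, a, ha, hu⟩ := F.complete u
  refine ⟨fun ρ => if ρ ∈ σ then a ρ else 0, fun ρ => ?_, ⟨σ, hσ, fun ρ hρ => if_neg hρ⟩, ?_⟩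
  · by_cases h : ρ ∈ σ
    · simpa [h] using ha ρ h
    · simp [h]
  · simp [hu, ite_smul, Finset.sum_ite_mem]

/-- The piecewise linear function `h^ρ`: on a cone `σ` containing the ray `ρ` it is the `ρ`-coordinate
with respect to the basis of ray generators of `σ`, and it vanishes on the cones not containing `ρ`
(see `h_eq`). -/
noncomputable def h (ρ : ι) (u : E) : ℝ := (F.exists_coords u).choose ρ

theorem coords_eq_aux {σ τ : Finset ι} (hσ : σ ∈ F.cones) (hτ : τ ∈ F.cones) {a b : ι → ℝ}
    (ha : ∀ ρ, 0 ≤ a ρ) (hb : ∀ ρ, 0 ≤ b ρ) (ha' : ∀ ρ ∉ σ, a ρ = 0) (hb' : ∀ ρ ∉ τ, b ρ = 0)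
    (hab : ∑ ρ, a ρ • F.v ρ = ∑ ρ, b ρ • F.v ρ) : a = b := by
  have hs : ∀ (s : Finset ι) (c : ι → ℝ), (∀ ρ ∉ s, c ρ = 0) →
      ∑ ρ, c ρ • F.v ρ = ∑ ρ ∈ s, c ρ • F.v ρ := fun s c hc =>
    (Finset.sum_subset (Finset.subset_univ s) fun ρ _ hρ => by simp [hc ρ hρ]).symm
  have hx := (F.inter_cone σ hσ τ hτ).subset
    ⟨⟨a, fun ρ _ => ha ρ, hs σ a ha'⟩, ⟨b, fun ρ _ => hb ρ, hab.trans (hs τ b hb')⟩⟩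
  obtain ⟨c, -, hc⟩ := hx
  let d : ι → ℝ := fun ρ => if ρ ∈ σ ∩ τ then c ρ else 0
  have hd : ∑ ρ, d ρ • F.v ρ = ∑ ρ ∈ σ ∩ τ, c ρ • F.v ρ := by
    simp only [d, ite_smul, zero_smul, Finset.sum_ite_mem, Finset.univ_inter]
  have key : ∀ s ∈ F.cones, ∀ e : ι → ℝ, (∀ ρ ∉ s, e ρ = 0) → (∀ ρ ∉ s, d ρ = 0) →
      ∑ ρ, e ρ • F.v ρ = ∑ ρ, d ρ • F.v ρ → e = d := by
    intro s hs' e he hds hed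
    have hli := linearIndepOn_finset_iff.1 (F.linearIndep s hs') (fun ρ => e ρ - d ρ) (by
      simp only [sub_smul, Finset.sum_sub_distrib, ← hs s e he, ← hs s d hds, hed, sub_self])
    funext ρ
    by_cases hρ : ρ ∈ s
    · exact sub_eq_zero.1 (hli ρ hρ)
    · rw [he ρ hρ, hds ρ hρ]
  have h1 := key σ hσ a ha' (fun ρ hρ => by simp [d, hρ]) (hc.trans hd.symm)
  have h2 := key τ hτ b hb' (fun ρ hρ => by simp [d, hρ]) (hab.symm.trans (hc.trans hd.symm))
  rw [h1, h2]

/-- The characterization of `h^ρ` on a cone `σ`. -/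
theorem h_eq {σ : Finset ι} (hσ : σ ∈ F.cones) {a : ι → ℝ} (ha : ∀ ρ, 0 ≤ a ρ)
    (ha' : ∀ ρ ∉ σ, a ρ = 0) {u : E} (hu : u = ∑ ρ, a ρ • F.v ρ) (ρ : ι) : F.h ρ u = a ρ := by
  obtain ⟨h0, ⟨τ, hτ, h1⟩, h2⟩ := (F.exists_coords u).choose_spec
  exact congrFun (F.coords_eq_aux hτ hσ h0 ha h1 ha' (h2.symm.trans hu)) ρ

end Linear

section Smoothing

variable {ι E : Type*} [Fintype ι] [DecidableEq ι] [NormedAddCommGroup E] [InnerProductSpace ℝ E]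
  [FiniteDimensional ℝ E] [MeasurableSpace E] [BorelSpace E]

instance isClosed_linearSpan (F : CompleteSimplicialFan ι E) (σ : Finset ι) :
    IsClosed (F.linearSpan σ : Set E) :=
  Submodule.closed_of_finiteDimensional _

variable (F : CompleteSimplicialFan ι E) (χ : E → ℝ) (r : ℝ → ℝ) (ε δ : ℝ)

/-- The convolution smoothing `h^ρ_δ = h^ρ * χ_δ`. -/
noncomputable def smoothH (ρ : ι) : E → ℝ :=
  MeasureTheory.convolution (F.h ρ) (scaledBump χ δ) (ContinuousLinearMap.mul ℝ ℝ)
    MeasureTheory.volume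

/-- The smoothed scaling vector field `x ↦ r(h^ρ_δ(x)) v_ρ`. -/
noncomputable def smoothField (ρ : ι) (x : E) : E :=
  r (F.smoothH χ δ ρ x) • F.v ρ

/-- The flow of the smoothed scaling vector field of the ray `ρ`. -/
noncomputable def smoothFlow (ρ : ι) : ℝ → E → E :=
  globalFlow (F.smoothField χ r δ ρ)

/-- The smoothed total scaling action of `ℝ^{Σ(1)}`. -/
noncomputable def smoothAction (t : ι → ℝ) : E → E :=
  composeAll (F.smoothFlow χ r δ) t

/-- The set `st^{fr}(σ)`. -/
def stFr (σ : Finset ι) : Set E :=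
  {x | ∀ ρ ∈ σ, ε < F.smoothH χ δ ρ x}

/-- The set `σ^{fr}`. -/
def coneFr (σ : Finset ι) : Set E :=
  {x ∈ F.relint σ | ∀ ρ ∈ σ, ε < F.smoothH χ δ ρ x}

/-- Equivariant coherent collections of projections `π σ : st^{fr}(σ) → σ^{fr}`, indexed by the
non-zero cones `σ` of the fan.  (The values of `π σ` outside `st^{fr}(σ)` are irrelevant.) -/
structure IsEquivariantCoherent (π : Finset ι → E → E) : Prop where
  mapsTo : ∀ σ ∈ F.cones, σ.Nonempty →
    Set.MapsTo (π σ) (F.stFr χ ε δ σ) (F.coneFr χ ε δ σ)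
  smooth : ∀ σ ∈ F.cones, σ.Nonempty → ContDiffOn ℝ ∞ (π σ) (F.stFr χ ε δ σ)
  /-- the fibres project diffeomorphically onto `(N/σ)_ℝ` -/
  fibre : ∀ σ ∈ F.cones, σ.Nonempty → ∀ b ∈ F.coneFr χ ε δ σ,
    ProjectsDiffeomorphically (F.linearSpan σ) {x ∈ F.stFr χ ε δ σ | π σ x = b}
  /-- coherence -/
  coherent : ∀ σ ∈ F.cones, ∀ τ ∈ F.cones, σ.Nonempty → σ ⊆ τ →
    ∀ x ∈ F.stFr χ ε δ τ, π τ x ∈ F.stFr χ ε δ σ ∧ x ∈ F.stFr χ ε δ σ ∧ π σ (π τ x) = π σ x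
  /-- equivariance for the subgroup `ℝ^{σ(1)}` of `ℝ^{Σ(1)}`, which acts on `st^{fr}(σ)` and on
  `σ^{fr}` -/
  equivariant : ∀ σ ∈ F.cones, σ.Nonempty → ∀ t : ι → ℝ, (∀ ρ ∉ σ, t ρ = 0) →
    Set.MapsTo (F.smoothAction χ r δ t) (F.stFr χ ε δ σ) (F.stFr χ ε δ σ) ∧
    Set.MapsTo (F.smoothAction χ r δ t) (F.coneFr χ ε δ σ) (F.coneFr χ ε δ σ) ∧
    ∀ x ∈ F.stFr χ ε δ σ, π σ (F.smoothAction χ r δ t x) = F.smoothAction χ r δ t (π σ x)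

end Smoothing

end CompleteSimplicialFan

/-! The functions `h ρ` are Lipschitz with a common constant `K`, so `smoothH` differs from `h` by
at most `K * δ`. Suppose `4 * (K * δ) ≤ ε`. If `smoothH` exceeds `ε` at `x` for every `ρ ∈ σ`, then
`h ρ` is positive on the whole `δ`-ball around `x`, so this ball lies in the open star of `σ`. There
a displacement `∑ t ρ • v ρ` along `σ` changes each `h ρ` by exactly `t ρ`, and averaging passes
this on to `smoothH` (`smoothH_add_sum`). Thus on `stFr` the functions `smoothH ρ`, `ρ ∈ σ`, are
affine coordinates along translates of `ℝσ`.

In these coordinates each scaling field is `r(y) ∂/∂y` in one variable, so its flow is given by the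
one-dimensional flow `φ` of `r`. The flows therefore commute, and the action is `explicitAction`.
The projection `proj` sends `x` to the only point of `coneFr` with the same coordinates `smoothH ρ`,
`ρ ∈ σ`. Coherence holds because `proj` depends only on these values and preserves them, and
equivariance because the action changes them through `φ`. For the fibres, each translate of `ℝσ`
contains exactly one point of `stFr` with prescribed coordinates above `ε`. -/

/-! ### Global flows of Lipschitz vector fields -/

open Set Filter Topology Manifold in
/-- A `C¹` vector field that is globally Lipschitz has a global flow. -/
theorem LipschitzWith.exists_isGlobalFlow {E : Type*} [NormedAddCommGroup E] [NormedSpace ℝ E]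
    [CompleteSpace E] {V : E → E} {K : NNReal} (hV : LipschitzWith K V) (hV' : ContDiff ℝ 1 V) :
    ∃ Φ : ℝ → E → E, IsGlobalFlow V Φ := by
  have key : ∀ x : E, ∃ γ : ℝ → E, γ 0 = x ∧ ∀ t, HasDerivAt γ (V (γ t)) t := by
    have hT : (0 : ℝ) < 1 / (2 * (K + 1)) := by positivity
    have hloc : ∀ x : E, ∃ γ : ℝ → E, γ 0 = x ∧ IsMIntegralCurveOn (I := 𝓘(ℝ, E)) γ V
        (Ioo (-(1 / (2 * ((K : ℝ) + 1)))) (1 / (2 * (K + 1)))) := by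
      intro x
      set T : ℝ := 1 / (2 * (K + 1)) with hTdef
      -- On the ball of radius `‖V x‖` the field is bounded by `(1 + K) * ‖V x‖`, so a solution
      -- cannot leave it before time `T`. As `T` does not depend on `x`, local solutions extend to
      -- all times.
      have hpl : IsPicardLindelof (fun _ => V) (tmin := -T) (tmax := T)
          ⟨0, by constructor <;> linarith⟩ x ‖V x‖₊ 0 (‖V x‖₊ + K * ‖V x‖₊) K := by
        refine ⟨fun _ _ => hV.lipschitzOnWith, fun _ _ => continuousOn_const, ?_, ?_⟩
        · intro _ _ y hy
          have h1 := hV.dist_le_mul y x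
          have h2 : dist y x ≤ ‖V x‖ := hy
          have h3 : ‖V y‖ ≤ ‖V x‖ + dist (V y) (V x) := by
            rw [dist_eq_norm]; exact norm_le_insert' _ _
          have h4 : (K : ℝ) * dist y x ≤ K * ‖V x‖ := by gcongr
          push_cast
          linarith
        · have : T * (2 * (K + 1)) = 1 := by rw [hTdef]; field_simp
          have h0 := norm_nonneg (V x)
          have hK : (0 : ℝ) ≤ K := K.2
          simp only [sub_zero, zero_sub, neg_neg, max_self]
          push_cast
          have h5 : (‖V x‖ + K * ‖V x‖) * T = ‖V x‖ * (T * (2 * (K + 1))) / 2 := by ring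
          rw [h5, this]
          simp
      obtain ⟨γ, h0, hγ⟩ := hpl.exists_eq_forall_mem_Icc_hasDerivWithinAt₀
      refine ⟨γ, h0, fun t ht => HasMFDerivAt.hasMFDerivWithinAt ?_⟩
      have := (hγ t (Ioo_subset_Icc_self ht)).hasDerivAt (Icc_mem_nhds ht.1 ht.2)
      exact this.hasFDerivAt.hasMFDerivAt
    intro x
    obtain ⟨γ, h0, hγ⟩ := exists_isMIntegralCurve_of_isMIntegralCurveOn (I := 𝓘(ℝ, E))
      (contMDiff_vectorSpace_iff_contDiff.2 hV') hT hloc x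
    refine ⟨γ, h0, fun t => ?_⟩
    have h : HasFDerivAt γ ((1 : ℝ →L[ℝ] ℝ).smulRight (V (γ t))) t := (hγ t).hasFDerivAt
    exact h.hasDerivAt.congr_deriv (by simp)
  choose γ h0 hγ using key
  exact ⟨fun t x => γ x t, fun x => ⟨h0 x, hγ x⟩⟩

theorem LipschitzWith.eq_of_hasDerivAt {E : Type*} [NormedAddCommGroup E] [NormedSpace ℝ E]
    {V : E → E} {K : NNReal} (hV : LipschitzWith K V) {f g : ℝ → E}
    (hf : ∀ t, HasDerivAt f (V (f t)) t) (hg : ∀ t, HasDerivAt g (V (g t)) t) {t₀ : ℝ}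
    (h : f t₀ = g t₀) : f = g :=
  ODE_solution_unique_univ (v := fun _ => V) (s := fun _ => Set.univ)
    (fun _ => hV.lipschitzOnWith) (fun t => ⟨hf t, trivial⟩) (fun t => ⟨hg t, trivial⟩) h

theorem globalFlow_spec {E : Type*} [NormedAddCommGroup E] [NormedSpace ℝ E]
    {V : E → E} (h : ∃ Φ, IsGlobalFlow V Φ) : IsGlobalFlow V (globalFlow V) := by
  rw [globalFlow, dif_pos h]
  exact h.choose_spec

namespace IsGlobalFlow

variable {E : Type*} [NormedAddCommGroup E] [NormedSpace ℝ E] {V : E → E} {K : NNReal}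
  {Φ : ℝ → E → E}

theorem eq_of_lipschitz (hV : LipschitzWith K V) (hΦ : IsGlobalFlow V Φ) {Ψ : ℝ → E → E}
    (hΨ : IsGlobalFlow V Ψ) : Φ = Ψ := by
  funext t x
  exact congrFun (hV.eq_of_hasDerivAt (hΦ x).2 (hΨ x).2 (t₀ := 0)
    ((hΦ x).1.trans (hΨ x).1.symm)) t

theorem add_apply (hV : LipschitzWith K V) (hΦ : IsGlobalFlow V Φ) (s t : ℝ) (x : E) :
    Φ (s + t) x = Φ s (Φ t x) :=
  congrFun (hV.eq_of_hasDerivAt (f := fun s => Φ (s + t) x)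
    (fun s => ((hΦ x).2 (s + t)).comp_add_const s t) (hΦ (Φ t x)).2 (t₀ := 0)
    (by simp [(hΦ (Φ t x)).1])) s

theorem eq_self_of_eq_zero (hV : LipschitzWith K V) (hΦ : IsGlobalFlow V Φ) {x : E}
    (hx : V x = 0) (t : ℝ) : Φ t x = x :=
  congrFun (hV.eq_of_hasDerivAt (hΦ x).2 (g := fun _ => x)
    (fun t => by rw [hx]; exact hasDerivAt_const t x) (t₀ := 0) (hΦ x).1) t

end IsGlobalFlow

/-! ### The one-dimensional flow of the ramp function -/

namespace IsSmoothedRamp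

variable {ε : ℝ} {r : ℝ → ℝ}

theorem eq_zero (hr : IsSmoothedRamp ε r) {x : ℝ} (hx : x ≤ ε) : r x = 0 := by
  by_contra h
  have : x ∈ Function.support r := h
  rw [hr.support_eq] at this
  exact absurd this (not_lt.2 hx)

/-- The derivative is `0` below `ε` and `1` above `2 * ε`; compactness bounds it in between. -/
theorem exists_lipschitzWith (hr : IsSmoothedRamp ε r) : ∃ K, LipschitzWith K r := by
  have hd : Differentiable ℝ r := hr.contDiff.differentiable (by simp)
  have hc : Continuous (deriv r) := hr.contDiff.continuous_deriv (by simp)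
  obtain ⟨C, hC⟩ := (isCompact_Icc (a := ε) (b := 2 * ε)).exists_bound_of_continuousOn
    hc.continuousOn
  refine ⟨(max C 1).toNNReal, lipschitzWith_of_nnnorm_deriv_le hd fun x => ?_⟩
  rw [← NNReal.coe_le_coe, coe_nnnorm, Real.coe_toNNReal _ (le_max_of_le_right zero_le_one)]
  rcases lt_or_ge x ε with h1 | h1
  · have : r =ᶠ[nhds x] fun _ => 0 := by
      filter_upwards [Iio_mem_nhds h1] with y hy using hr.eq_zero hy.le
    rw [this.deriv_eq]; simp
  rcases le_or_gt x (2 * ε) with h2 | h2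
  · exact (hC x ⟨h1, h2⟩).trans (le_max_left _ _)
  · have : r =ᶠ[nhds x] fun y => y - ε := by
      filter_upwards [Ioi_mem_nhds h2] with y hy using hr.eq_of_gt y hy
    rw [this.deriv_eq]; simp

theorem exists_isGlobalFlow (hr : IsSmoothedRamp ε r) : ∃ φ, IsGlobalFlow r φ :=
  hr.exists_lipschitzWith.choose_spec.exists_isGlobalFlow (hr.contDiff.of_le (by simp))

theorem flow_eq_self (hr : IsSmoothedRamp ε r) {φ : ℝ → ℝ → ℝ} (hφ : IsGlobalFlow r φ) {y : ℝ}
    (hy : y ≤ ε) (t : ℝ) : φ t y = y :=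
  hφ.eq_self_of_eq_zero hr.exists_lipschitzWith.choose_spec (hr.eq_zero hy) t

theorem flow_add (hr : IsSmoothedRamp ε r) {φ : ℝ → ℝ → ℝ} (hφ : IsGlobalFlow r φ) (s t y : ℝ) :
    φ (s + t) y = φ s (φ t y) :=
  hφ.add_apply hr.exists_lipschitzWith.choose_spec s t y

/-- Values at most `ε` are fixed by the flow, so a trajectory that reached one could not flow back
to `y`. -/
theorem lt_flow (hr : IsSmoothedRamp ε r) {φ : ℝ → ℝ → ℝ} (hφ : IsGlobalFlow r φ) {y : ℝ}
    (hy : ε < y) (t : ℝ) : ε < φ t y := by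
  by_contra h
  have h1 := hr.flow_add hφ (-t) t y
  rw [hr.flow_eq_self hφ (not_lt.1 h), neg_add_cancel, (hφ y).1] at h1
  exact h (h1 ▸ hy)

end IsSmoothedRamp

/-! ### Lipschitz continuity of the piecewise linear functions -/

open Filter Topology in
/-- A function whose pointwise Lipschitz constant is everywhere at most `K` is `K`-Lipschitz. -/
theorem LipschitzWith.of_eventually_abs_sub_le {E : Type*} [NormedAddCommGroup E]
    [NormedSpace ℝ E] {f : E → ℝ} {K : NNReal}
    (hf : ∀ x, ∀ᶠ y in 𝓝 x, |f y - f x| ≤ K * ‖y - x‖) : LipschitzWith K f := by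
  have hc : Continuous f := by
    refine continuous_iff_continuousAt.2 fun x => ?_
    rw [ContinuousAt, tendsto_iff_dist_tendsto_zero]
    refine squeeze_zero' (g := fun y => K * ‖y - x‖) (.of_forall fun _ => dist_nonneg)
      (by simpa only [Real.dist_eq] using hf x) ?_
    have : Continuous fun y : E => (K : ℝ) * ‖y - x‖ := by fun_prop
    simpa using this.tendsto x
  have key : ∀ x y, f y ≤ f x + K * ‖y - x‖ := by
    intro x y
    let p : ℝ → E := fun t => x + t • (y - x)
    have hp : Continuous p := by fun_prop
    -- Along the segment, the pointwise bound controls right-hand slopes by `K * ‖y - x‖`, so the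
    -- function stays below the affine one of that slope.
    have := image_le_of_liminf_slope_right_le_deriv_boundary (f := fun t => f (p t))
      (a := 0) (b := 1) (hc.comp hp).continuousOn
      (B := fun t => f x + K * ‖y - x‖ * t) (B' := fun _ => K * ‖y - x‖) (by simp [p])
      (by fun_prop) (fun t _ => by
        simpa using ((hasDerivAt_id t).const_mul ((K : ℝ) * ‖y - x‖)).const_add (f x)
          |>.hasDerivWithinAt) ?_ (Set.right_mem_Icc.2 zero_le_one)
    · simpa [p] using this
    intro t _ c hct
    refine Eventually.frequently ?_
    have h1 := hp.continuousAt.eventually (hf (p t))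
    filter_upwards [h1.filter_mono nhdsWithin_le_nhds, self_mem_nhdsWithin] with s hs hst
    have hst' : 0 < s - t := sub_pos.2 hst
    rw [slope_def_field, div_lt_iff₀ hst']
    have h2 : p s - p t = (s - t) • (y - x) := by simp only [p, sub_smul]; abel
    rw [h2, norm_smul, Real.norm_of_nonneg hst'.le] at hs
    calc f (p s) - f (p t) ≤ K * ((s - t) * ‖y - x‖) := (le_abs_self _).trans hs
      _ = K * ‖y - x‖ * (s - t) := by ring
      _ < c * (s - t) := by gcongr
  refine LipschitzWith.of_dist_le_mul fun x y => ?_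
  rw [Real.dist_eq, dist_eq_norm, abs_sub_le_iff]
  have h1 := key x y
  have h2 := key y x
  rw [norm_sub_rev] at h1
  constructor <;> linarith

namespace CompleteSimplicialFan

section Linear

variable {ι E : Type*} [Fintype ι] [DecidableEq ι] [AddCommGroup E] [Module ℝ E]
  (F : CompleteSimplicialFan ι E)

theorem h_nonneg (ρ : ι) (u : E) : 0 ≤ F.h ρ u :=
  (F.exists_coords u).choose_spec.1 ρ

theorem exists_cone_h_eq_zero (u : E) : ∃ σ ∈ F.cones, ∀ ρ ∉ σ, F.h ρ u = 0 :=
  (F.exists_coords u).choose_spec.2.1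

theorem sum_h_smul (u : E) : ∑ ρ, F.h ρ u • F.v ρ = u :=
  (F.exists_coords u).choose_spec.2.2.symm

/-- On the open star of `σ`, moving inside the span of `σ` changes the functions `h ρ` by the
coordinates of the displacement. -/
theorem h_add_sum {σ : Finset ι} {u : E} {t : ι → ℝ} (hu : ∀ ρ ∈ σ, 0 < F.h ρ u)
    (ht : ∀ ρ ∈ σ, 0 ≤ F.h ρ u + t ρ) (ht' : ∀ ρ ∉ σ, t ρ = 0) (ρ : ι) :
    F.h ρ (u + ∑ ρ, t ρ • F.v ρ) = F.h ρ u + t ρ := by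
  obtain ⟨τ, hτ, h0⟩ := F.exists_cone_h_eq_zero u
  have hστ : ∀ ρ ∉ τ, ρ ∉ σ := fun ρ hρ hρσ => (hu ρ hρσ).ne' (h0 ρ hρ)
  refine F.h_eq hτ (a := fun ρ => F.h ρ u + t ρ) (fun ρ => ?_) (fun ρ hρ => ?_) ?_ ρ
  · by_cases hρ : ρ ∈ σ
    · exact ht ρ hρ
    · simpa [ht' ρ hρ] using F.h_nonneg ρ u
  · simp only [h0 ρ hρ, ht' ρ (hστ ρ hρ), add_zero]
  · simp only [add_smul, Finset.sum_add_distrib, F.sum_h_smul]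

theorem h_sum_of_mem_cones {σ : Finset ι} (hσ : σ ∈ F.cones) {a : ι → ℝ} (ha : ∀ ρ ∈ σ, 0 ≤ a ρ)
    {ρ : ι} (hρ : ρ ∈ σ) : F.h ρ (∑ ρ ∈ σ, a ρ • F.v ρ) = a ρ := by
  refine (F.h_eq hσ (a := fun ρ => if ρ ∈ σ then a ρ else 0) (fun ρ => ?_)
    (fun ρ hρ => if_neg hρ) ?_ ρ).trans (if_pos hρ)
  · split_ifs with h
    exacts [ha ρ h, le_rfl]
  · simp [ite_smul, Finset.sum_ite_mem]

end Linear

section Smoothing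

variable {ι E : Type*} [Fintype ι] [DecidableEq ι] [NormedAddCommGroup E] [InnerProductSpace ℝ E]
  [FiniteDimensional ℝ E] (F : CompleteSimplicialFan ι E)

theorem exists_coord_functionals {σ : Finset ι} (hσ : σ ∈ F.cones) : ∃ g : ι → E →L[ℝ] ℝ,
    ∀ a : ι → ℝ, (∀ ρ ∉ σ, a ρ = 0) → ∀ ρ, g ρ (∑ ρ, a ρ • F.v ρ) = a ρ := by
  have hli : LinearIndependent ℝ fun i : σ => F.v i := F.linearIndep σ hσ
  obtain ⟨g, hg⟩ := (Fintype.linearCombination ℝ fun i : σ => F.v i).exists_leftInverse_of_injective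
    (LinearMap.ker_eq_bot.2 hli.fintypeLinearCombination_injective)
  refine ⟨fun ρ => if h : ρ ∈ σ then
    LinearMap.toContinuousLinearMap (LinearMap.proj ⟨ρ, h⟩ ∘ₗ g) else 0, fun a ha ρ => ?_⟩
  by_cases h : ρ ∈ σ
  · have h1 : ∑ ρ, a ρ • F.v ρ =
        Fintype.linearCombination ℝ (fun i : σ => F.v i) (fun i : σ => a i) := by
      rw [Fintype.linearCombination_apply, Finset.sum_coe_sort σ fun i => a i • F.v i]
      exact (Finset.sum_subset (Finset.subset_univ σ) fun ρ _ hρ => by simp [ha ρ hρ]).symm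
    have h2 := LinearMap.congr_fun hg (fun i : σ => a i)
    simp only [LinearMap.comp_apply, LinearMap.id_apply] at h2
    simp [h, h1, h2]
  · simp [h, ha ρ h]

/-- There are finitely many cones and they are closed, so every point near `x` lies in a cone that
also contains `x`. On that cone `h ρ` agrees with a linear functional, and the sum of all operator
norms serves as a common constant. -/
theorem exists_lipschitzWith_h : ∃ K : NNReal, ∀ ρ, LipschitzWith K (F.h ρ) := by
  choose g hg using fun σ : F.cones => F.exists_coord_functionals σ.2
  have : Finite F.cones := Set.toFinite _
  have := Fintype.ofFinite F.cones
  let C : F.cones → Set E := fun σ => {x | (∀ ρ, 0 ≤ g σ ρ x) ∧ (∀ ρ ∉ σ.1, g σ ρ x = 0) ∧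
    x = ∑ ρ, g σ ρ x • F.v ρ}
  have hC : ∀ σ, IsClosed (C σ) := by
    intro σ
    simp only [C, Set.ofPred_and, Set.ofPred_forall]
    refine IsClosed.inter (isClosed_iInter fun ρ => isClosed_le continuous_const (by fun_prop))
      (IsClosed.inter (isClosed_iInter fun ρ => isClosed_iInter fun _ =>
        isClosed_eq (by fun_prop) continuous_const) (isClosed_eq continuous_id (by fun_prop)))
  have hCh : ∀ σ, ∀ x ∈ C σ, ∀ ρ, F.h ρ x = g σ ρ x := fun σ x hx ρ =>
    F.h_eq σ.2 hx.1 hx.2.1 hx.2.2 ρ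
  have hcov : ∀ x, ∃ σ, x ∈ C σ := by
    intro x
    obtain ⟨σ, hσ, h0⟩ := F.exists_cone_h_eq_zero x
    have : ∀ ρ, g ⟨σ, hσ⟩ ρ x = F.h ρ x := fun ρ => by
      conv_lhs => rw [← F.sum_h_smul x]
      exact hg ⟨σ, hσ⟩ (fun ρ => F.h ρ x) h0 ρ
    refine ⟨⟨σ, hσ⟩, fun ρ => ?_, fun ρ hρ => ?_, ?_⟩
    · rw [this]; exact F.h_nonneg ρ x
    · rw [this]; exact h0 ρ hρ
    · simp only [this, F.sum_h_smul]
  refine ⟨∑ σ, ∑ ρ, ‖g σ ρ‖₊, fun ρ => LipschitzWith.of_eventually_abs_sub_le fun x => ?_⟩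
  have hev : ∀ᶠ y in nhds x, ∀ σ, x ∉ C σ → y ∉ C σ := by
    refine Filter.eventually_all.2 fun σ => ?_
    by_cases hx : x ∈ C σ
    · exact .of_forall fun _ h => absurd hx h
    · filter_upwards [(hC σ).isOpen_compl.mem_nhds hx] with y hy _ using hy
  filter_upwards [hev] with y hy
  obtain ⟨σ, hyσ⟩ := hcov y
  have hxσ : x ∈ C σ := by
    by_contra h
    exact hy σ h hyσ
  rw [hCh σ y hyσ, hCh σ x hxσ, ← map_sub, ← Real.norm_eq_abs]
  refine ((g σ ρ).le_opNorm _).trans (mul_le_mul_of_nonneg_right ?_ (norm_nonneg _))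
  rw [← coe_nnnorm, NNReal.coe_le_coe]
  exact (Finset.single_le_sum (f := fun ρ => ‖g σ ρ‖₊) (fun _ _ => zero_le) (Finset.mem_univ ρ)).trans
    (Finset.single_le_sum (f := fun σ => ∑ ρ, ‖g σ ρ‖₊) (fun _ _ => zero_le) (Finset.mem_univ σ))

end Smoothing

end CompleteSimplicialFan

/-! ### Averaging against the rescaled bump -/

section ScaledBump

open MeasureTheory

variable {E : Type*} [NormedAddCommGroup E] [InnerProductSpace ℝ E]
  [FiniteDimensional ℝ E] [MeasurableSpace E] [BorelSpace E] {χ : E → ℝ} {δ : ℝ}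

namespace IsRadialBump

theorem contDiff_scaledBump (hχ : IsRadialBump χ) : ContDiff ℝ ∞ (scaledBump χ δ) :=
  contDiff_const.mul (hχ.contDiff.comp (contDiff_const_smul _))

theorem scaledBump_nonneg (hχ : IsRadialBump χ) (hδ : 0 < δ) (x : E) : 0 ≤ scaledBump χ δ x :=
  mul_nonneg (by positivity) (hχ.nonneg _)

theorem norm_le_of_scaledBump_ne_zero (hχ : IsRadialBump χ) (hδ : 0 < δ) {x : E}
    (hx : scaledBump χ δ x ≠ 0) : ‖x‖ ≤ δ := by
  have h1 : δ⁻¹ • x ∈ Metric.closedBall (0 : E) 1 := hχ.support_subset (right_ne_zero_of_mul hx)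
  rw [mem_closedBall_zero_iff, norm_smul, norm_inv, Real.norm_of_nonneg hδ.le,
    inv_mul_le_iff₀ hδ, mul_one] at h1
  exact h1

theorem hasCompactSupport_scaledBump (hχ : IsRadialBump χ) (hδ : 0 < δ) :
    HasCompactSupport (scaledBump χ δ) := by
  refine HasCompactSupport.intro (isCompact_closedBall (0 : E) δ) fun x hx => ?_
  by_contra h
  exact hx (mem_closedBall_zero_iff.2 (hχ.norm_le_of_scaledBump_ne_zero hδ h))

theorem integral_scaledBump (hχ : IsRadialBump χ) (hδ : 0 < δ) : ∫ x, scaledBump χ δ x = 1 := by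
  unfold scaledBump
  rw [integral_const_mul, Measure.integral_comp_inv_smul_of_nonneg _ _ hδ.le, hχ.integral_eq_one,
    smul_eq_mul, mul_one, inv_mul_cancel₀ (by positivity)]

theorem integrable_mul_scaledBump (hχ : IsRadialBump χ) (hδ : 0 < δ) {f : E → ℝ}
    (hf : Continuous f) : Integrable fun y => f y * scaledBump χ δ y :=
  (hf.mul hχ.contDiff_scaledBump.continuous).integrable_of_hasCompactSupport
    (hχ.hasCompactSupport_scaledBump hδ).mul_left

/-- The average of a function with respect to a rescaled bump function depends only on its values on
the closed ball of radius `δ`, with control of the error. -/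
theorem abs_integral_mul_scaledBump_sub_le (hχ : IsRadialBump χ) (hδ : 0 < δ) {f g : E → ℝ}
    (hf : Continuous f) (hg : Continuous g) {c d : ℝ} (h : ∀ y, ‖y‖ ≤ δ → |f y - g y - d| ≤ c) :
    |(∫ y, f y * scaledBump χ δ y) - (∫ y, g y * scaledBump χ δ y) - d| ≤ c := by
  have hd : ∫ y, d * scaledBump χ δ y = d := by
    rw [integral_const_mul, hχ.integral_scaledBump hδ, mul_one]
  have hc : ∫ y, c * scaledBump χ δ y = c := by
    rw [integral_const_mul, hχ.integral_scaledBump hδ, mul_one]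
  have hfi := hχ.integrable_mul_scaledBump hδ hf
  have hgi := hχ.integrable_mul_scaledBump hδ hg
  have hi : (∫ y, f y * scaledBump χ δ y) - (∫ y, g y * scaledBump χ δ y) - d =
      ∫ y, f y * scaledBump χ δ y - g y * scaledBump χ δ y - d * scaledBump χ δ y := by
    have h1 := integral_sub (hfi.sub hgi) (hχ.integrable_mul_scaledBump hδ (continuous_const (y := d)))
    rw [hd] at h1
    rw [← integral_sub hfi hgi]
    exact h1.symm
  rw [hi, ← hc, ← Real.norm_eq_abs]
  refine norm_integral_le_of_norm_le (hχ.integrable_mul_scaledBump hδ continuous_const)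
    (.of_forall fun y => ?_)
  rw [← sub_mul, ← sub_mul, norm_mul, Real.norm_of_nonneg (hχ.scaledBump_nonneg hδ y),
    Real.norm_eq_abs]
  by_cases hy : scaledBump χ δ y = 0
  · simp [hy]
  · exact mul_le_mul_of_nonneg_right (h y (hχ.norm_le_of_scaledBump_ne_zero hδ hy))
      (hχ.scaledBump_nonneg hδ y)

end IsRadialBump

end ScaledBump

/-! ### The smoothed functions as coordinates along cones -/

namespace CompleteSimplicialFan

section Smoothing

variable {ι E : Type*} [Fintype ι] [DecidableEq ι] [NormedAddCommGroup E] [InnerProductSpace ℝ E]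
  [FiniteDimensional ℝ E] [MeasurableSpace E] [BorelSpace E]
  (F : CompleteSimplicialFan ι E) {χ : E → ℝ} {ε δ : ℝ} {K : NNReal}

theorem smoothH_eq_integral (ρ : ι) (x : E) :
    F.smoothH χ δ ρ x = ∫ y, F.h ρ (x - y) * scaledBump χ δ y :=
  MeasureTheory.convolution_mul_swap

theorem contDiff_smoothH (hK : ∀ ρ, LipschitzWith K (F.h ρ)) (hχ : IsRadialBump χ) (hδ : 0 < δ)
    (ρ : ι) : ContDiff ℝ ∞ (F.smoothH χ δ ρ) :=
  (hχ.hasCompactSupport_scaledBump hδ).contDiff_convolution_right _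
    (hK ρ).continuous.locallyIntegrable hχ.contDiff_scaledBump

theorem lipschitzWith_smoothH (hK : ∀ ρ, LipschitzWith K (F.h ρ)) (hχ : IsRadialBump χ)
    (hδ : 0 < δ) (ρ : ι) : LipschitzWith K (F.smoothH χ δ ρ) := by
  have hc := (hK ρ).continuous
  refine LipschitzWith.of_dist_le_mul fun x x' => ?_
  rw [Real.dist_eq, smoothH_eq_integral, smoothH_eq_integral, ← sub_zero (_ - _)]
  refine hχ.abs_integral_mul_scaledBump_sub_le hδ (by fun_prop) (by fun_prop) fun y _ => ?_
  rw [sub_zero, ← Real.dist_eq]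
  simpa using (hK ρ).dist_le_mul (x - y) (x' - y)

theorem abs_smoothH_sub_le (hK : ∀ ρ, LipschitzWith K (F.h ρ)) (hχ : IsRadialBump χ)
    (hδ : 0 < δ) (ρ : ι) {x z : E} {c : ℝ} (hz : ∀ y, ‖y‖ ≤ δ → ‖x - y - z‖ ≤ c) :
    |F.smoothH χ δ ρ x - F.h ρ z| ≤ K * c := by
  have hc := (hK ρ).continuous
  have := hχ.abs_integral_mul_scaledBump_sub_le hδ (f := fun y => F.h ρ (x - y)) (g := fun _ => 0)
    (c := K * c) (d := F.h ρ z) (by fun_prop) (by fun_prop) fun y hy => by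
      rw [sub_zero, ← Real.dist_eq]
      refine ((hK ρ).dist_le_mul _ _).trans ?_
      rw [dist_eq_norm]
      gcongr
      exact hz y hy
  simpa [smoothH_eq_integral] using this

theorem abs_smoothH_sub_h_le (hK : ∀ ρ, LipschitzWith K (F.h ρ)) (hχ : IsRadialBump χ)
    (hδ : 0 < δ) (ρ : ι) (x : E) : |F.smoothH χ δ ρ x - F.h ρ x| ≤ K * δ :=
  F.abs_smoothH_sub_le hK hχ hδ ρ fun y hy => by simpa using hy

/-- On `st^{fr}(σ)`, moving inside the span of `σ` changes the functions `h^ρ_δ` by the coordinates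
of the displacement, as long as one does not leave `st^{fr}(σ)` in these coordinates. -/
theorem smoothH_add_sum (hK : ∀ ρ, LipschitzWith K (F.h ρ)) (hχ : IsRadialBump χ)
    (hδ : 0 < δ) (hε : 4 * (K * δ) ≤ ε) (hε' : 0 < ε) {σ : Finset ι} {x : E} {t : ι → ℝ}
    (hx : ∀ ρ ∈ σ, ε < F.smoothH χ δ ρ x) (ht : ∀ ρ ∈ σ, ε < F.smoothH χ δ ρ x + t ρ)
    (ht' : ∀ ρ ∉ σ, t ρ = 0) (ρ : ι) :
    F.smoothH χ δ ρ (x + ∑ ρ, t ρ • F.v ρ) = F.smoothH χ δ ρ x + t ρ := by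
  have hc := (hK ρ).continuous
  -- Points of the `δ`-ball are at distance at most `2 * δ` from each other. So `h` at `x - y`
  -- exceeds `ε - 2 * (K * δ) > 0`, before and after the displacement, as `h_add_sum` requires.
  have hb : ∀ y, ‖y‖ ≤ δ → ∀ ρ, F.smoothH χ δ ρ x - F.h ρ (x - y) ≤ 2 * (K * δ) := by
    intro y hy ρ
    refine (le_abs_self _).trans ((F.abs_smoothH_sub_le hK hχ hδ ρ (c := 2 * δ)
      fun y' hy' => ?_).trans_eq (by ring))
    rw [sub_sub_sub_cancel_left, two_mul]
    exact (norm_sub_le _ _).trans (add_le_add hy hy')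
  have := hχ.abs_integral_mul_scaledBump_sub_le hδ
    (f := fun y => F.h ρ (x + ∑ ρ, t ρ • F.v ρ - y)) (g := fun y => F.h ρ (x - y))
    (c := 0) (d := t ρ) (by fun_prop) (by fun_prop) fun y hy => by
      have h1 : x + ∑ ρ, t ρ • F.v ρ - y = x - y + ∑ ρ, t ρ • F.v ρ := by abel
      rw [h1, F.h_add_sum (σ := σ) (fun ρ' hρ' => by linarith [hb y hy ρ', hx ρ' hρ'])
        (fun ρ' hρ' => by linarith [hb y hy ρ', ht ρ' hρ']) ht']
      simp
  have := abs_nonpos_iff.1 this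
  rw [smoothH_eq_integral, smoothH_eq_integral]
  linarith

/-- Both `x` and the end point reach the common point `x + ∑ (t ρ + |t ρ|) • v ρ` by displacements
with non-negative coordinates. Such displacements keep the values above `ε`, so `smoothH_add_sum`
applies to each, and the results are subtracted. -/
theorem smoothH_add_sum_of_mem (hK : ∀ ρ, LipschitzWith K (F.h ρ)) (hχ : IsRadialBump χ)
    (hδ : 0 < δ) (hε : 4 * (K * δ) ≤ ε) (hε' : 0 < ε) {σ : Finset ι} {x : E} {t : ι → ℝ}
    (hx : x ∈ F.stFr χ ε δ σ) (hx' : x + ∑ ρ, t ρ • F.v ρ ∈ F.stFr χ ε δ σ)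
    (ht' : ∀ ρ ∉ σ, t ρ = 0) (ρ : ι) :
    F.smoothH χ δ ρ (x + ∑ ρ, t ρ • F.v ρ) = F.smoothH χ δ ρ x + t ρ := by
  have h1 := F.smoothH_add_sum hK hχ hδ hε hε' hx (t := fun ρ => t ρ + |t ρ|)
    (fun ρ hρ => by linarith [hx ρ hρ, neg_abs_le (t ρ)]) (fun ρ hρ => by simp [ht' ρ hρ]) ρ
  have h2 := F.smoothH_add_sum hK hχ hδ hε hε' hx' (t := fun ρ => |t ρ|)
    (fun ρ hρ => by linarith [hx' ρ hρ, abs_nonneg (t ρ)]) (fun ρ hρ => by simp [ht' ρ hρ]) ρ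
  simp only [add_smul, Finset.sum_add_distrib, ← add_assoc] at h1
  linarith

end Smoothing

end CompleteSimplicialFan

/-! ### The explicit form of the action -/

namespace CompleteSimplicialFan

section Linear

variable {ι E : Type*} [Fintype ι] [DecidableEq ι] [AddCommGroup E] [Module ℝ E]
  (F : CompleteSimplicialFan ι E)

/-- A point of `σ`, which lies in `σ^{fr}` if `δ` is small compared to `ε`. -/
noncomputable def basePoint (ε : ℝ) (σ : Finset ι) : E :=
  ∑ ρ ∈ σ, (2 * ε) • F.v ρ

theorem basePoint_add_sum {σ : Finset ι} {ε : ℝ} {t : ι → ℝ} (ht : ∀ ρ ∉ σ, t ρ = 0) :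
    F.basePoint ε σ + ∑ ρ, t ρ • F.v ρ = ∑ ρ ∈ σ, (2 * ε + t ρ) • F.v ρ := by
  rw [basePoint, ← Finset.sum_subset (Finset.subset_univ σ) fun ρ _ hρ => by
    rw [ht ρ hρ, zero_smul], ← Finset.sum_add_distrib]
  simp only [add_smul]

end Linear

section Smoothing

variable {ι E : Type*} [Fintype ι] [DecidableEq ι] [NormedAddCommGroup E] [InnerProductSpace ℝ E]
  [FiniteDimensional ℝ E] [MeasurableSpace E] [BorelSpace E]
  (F : CompleteSimplicialFan ι E) {χ : E → ℝ} {r : ℝ → ℝ} {ε δ : ℝ} {K : NNReal}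
  {φ : ℝ → ℝ → ℝ}

/-- The explicit form of the smoothed total scaling action, in terms of the flow `φ` of the ramp
function. -/
noncomputable def explicitAction (χ : E → ℝ) (δ : ℝ) (φ : ℝ → ℝ → ℝ) (t : ι → ℝ) (x : E) : E :=
  x + ∑ ρ, (φ (t ρ) (F.smoothH χ δ ρ x) - F.smoothH χ δ ρ x) • F.v ρ

theorem smoothH_explicitAction (hK : ∀ ρ, LipschitzWith K (F.h ρ)) (hχ : IsRadialBump χ)
    (hδ : 0 < δ) (hε : 4 * (K * δ) ≤ ε) (hε' : 0 < ε) (hr : IsSmoothedRamp ε r)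
    (hφ : IsGlobalFlow r φ) (t : ι → ℝ) (x : E) (ρ : ι) :
    F.smoothH χ δ ρ (F.explicitAction χ δ φ t x) = φ (t ρ) (F.smoothH χ δ ρ x) := by
  classical
  -- Only rays with value above `ε` move, since `φ` fixes the other values. The set of these rays
  -- need not be known to be a cone.
  rw [explicitAction, F.smoothH_add_sum hK hχ hδ hε hε'
    (σ := Finset.univ.filter fun ρ => ε < F.smoothH χ δ ρ x)
    (t := fun ρ => φ (t ρ) (F.smoothH χ δ ρ x) - F.smoothH χ δ ρ x)]
  · ring
  · exact fun ρ hρ => (Finset.mem_filter.1 hρ).2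
  · intro ρ hρ
    rw [add_sub_cancel]
    exact hr.lt_flow hφ (Finset.mem_filter.1 hρ).2 _
  · intro ρ hρ
    rw [hr.flow_eq_self hφ (by simpa using hρ), sub_self]

theorem explicitAction_zero (hφ : IsGlobalFlow r φ) : F.explicitAction χ δ φ 0 = id := by
  funext x
  simp [explicitAction, (hφ _).1]

theorem explicitAction_add (hK : ∀ ρ, LipschitzWith K (F.h ρ)) (hχ : IsRadialBump χ)
    (hδ : 0 < δ) (hε : 4 * (K * δ) ≤ ε) (hε' : 0 < ε) (hr : IsSmoothedRamp ε r)
    (hφ : IsGlobalFlow r φ) (t t' : ι → ℝ) :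
    F.explicitAction χ δ φ (t + t') = F.explicitAction χ δ φ t ∘ F.explicitAction χ δ φ t' := by
  funext x
  conv_rhs => rw [Function.comp_apply, explicitAction]
  simp only [F.smoothH_explicitAction hK hχ hδ hε hε' hr hφ, ← hr.flow_add hφ]
  rw [explicitAction, explicitAction, add_assoc, ← Finset.sum_add_distrib]
  congr 1
  refine Finset.sum_congr rfl fun ρ _ => ?_
  rw [← add_smul, Pi.add_apply]
  congr 1
  ring

theorem isGlobalFlow_explicitAction_single (hK : ∀ ρ, LipschitzWith K (F.h ρ))
    (hχ : IsRadialBump χ) (hδ : 0 < δ) (hε : 4 * (K * δ) ≤ ε) (hε' : 0 < ε)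
    (hr : IsSmoothedRamp ε r) (hφ : IsGlobalFlow r φ) (ρ : ι) :
    IsGlobalFlow (F.smoothField χ r δ ρ) fun s => F.explicitAction χ δ φ (Pi.single ρ s) := by
  refine fun x => ⟨by simp [F.explicitAction_zero hφ], fun t => ?_⟩
  have h1 : (fun s => F.explicitAction χ δ φ (Pi.single ρ s) x) = fun s =>
      x + (φ s (F.smoothH χ δ ρ x) - F.smoothH χ δ ρ x) • F.v ρ := by
    funext s
    rw [explicitAction, Finset.sum_eq_single_of_mem ρ (Finset.mem_univ ρ) fun ρ' _ h => by
      rw [Pi.single_eq_of_ne h, (hφ _).1, sub_self, zero_smul], Pi.single_eq_same]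
  rw [h1, smoothField, F.smoothH_explicitAction hK hχ hδ hε hε' hr hφ, Pi.single_eq_same]
  exact ((((hφ _).2 t).sub_const _).smul_const _).const_add _

theorem exists_lipschitzWith_smoothField (hK : ∀ ρ, LipschitzWith K (F.h ρ))
    (hχ : IsRadialBump χ) (hδ : 0 < δ) (hr : IsSmoothedRamp ε r) (ρ : ι) :
    ∃ C, LipschitzWith C (F.smoothField χ r δ ρ) := by
  obtain ⟨K', hK'⟩ := hr.exists_lipschitzWith
  exact ⟨_, (ContinuousLinearMap.toSpanSingleton ℝ (F.v ρ)).lipschitz.comp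
    (hK'.comp (F.lipschitzWith_smoothH hK hχ hδ ρ))⟩

theorem isGlobalFlow_smoothFlow (hK : ∀ ρ, LipschitzWith K (F.h ρ))
    (hχ : IsRadialBump χ) (hδ : 0 < δ) (hε : 4 * (K * δ) ≤ ε) (hε' : 0 < ε)
    (hr : IsSmoothedRamp ε r) (ρ : ι) :
    IsGlobalFlow (F.smoothField χ r δ ρ) (F.smoothFlow χ r δ ρ) :=
  globalFlow_spec ⟨_, F.isGlobalFlow_explicitAction_single hK hχ hδ hε hε' hr
    hr.exists_isGlobalFlow.choose_spec ρ⟩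

theorem smoothFlow_eq (hK : ∀ ρ, LipschitzWith K (F.h ρ))
    (hχ : IsRadialBump χ) (hδ : 0 < δ) (hε : 4 * (K * δ) ≤ ε) (hε' : 0 < ε)
    (hr : IsSmoothedRamp ε r) (hφ : IsGlobalFlow r φ) (ρ : ι) (s : ℝ) :
    F.smoothFlow χ r δ ρ s = F.explicitAction χ δ φ (Pi.single ρ s) :=
  congrFun ((F.isGlobalFlow_smoothFlow hK hχ hδ hε hε' hr ρ).eq_of_lipschitz
    (F.exists_lipschitzWith_smoothField hK hχ hδ hr ρ).choose_spec
    (F.isGlobalFlow_explicitAction_single hK hχ hδ hε hε' hr hφ ρ)) s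

theorem smoothAction_eq (hK : ∀ ρ, LipschitzWith K (F.h ρ))
    (hχ : IsRadialBump χ) (hδ : 0 < δ) (hε : 4 * (K * δ) ≤ ε) (hε' : 0 < ε)
    (hr : IsSmoothedRamp ε r) (hφ : IsGlobalFlow r φ) (t : ι → ℝ) :
    F.smoothAction χ r δ t = F.explicitAction χ δ φ t := by
  have key : ∀ l : List ι, (l.map fun ρ => F.smoothFlow χ r δ ρ (t ρ)).foldr (fun f g => f ∘ g) id =
      F.explicitAction χ δ φ (l.map fun ρ => Pi.single ρ (t ρ)).sum := by
    intro l
    induction l with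
    | nil => simp [F.explicitAction_zero hφ]
    | cons ρ l ih =>
      rw [List.map_cons, List.foldr_cons, ih, List.map_cons, List.sum_cons,
        F.explicitAction_add hK hχ hδ hε hε' hr hφ, F.smoothFlow_eq hK hχ hδ hε hε' hr hφ]
  rw [smoothAction, composeAll, key, Finset.sum_map_toList, Finset.univ_sum_single]

/-! ### The projections and their properties -/

/-- The projection `st^{fr}(σ) → σ^{fr}`: the image of `x` is the point of `σ^{fr}` at which the
functions `h^ρ_δ`, `ρ ∈ σ`, take the same values as at `x`. -/
noncomputable def proj (χ : E → ℝ) (ε δ : ℝ) (σ : Finset ι) (x : E) : E :=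
  F.basePoint ε σ + ∑ ρ, (if ρ ∈ σ then
    F.smoothH χ δ ρ x - F.smoothH χ δ ρ (F.basePoint ε σ) else 0) • F.v ρ

theorem smoothH_basePoint (hK : ∀ ρ, LipschitzWith K (F.h ρ)) (hχ : IsRadialBump χ)
    (hδ : 0 < δ) (hε' : 0 < ε) {σ : Finset ι} (hσ : σ ∈ F.cones) {ρ : ι} (hρ : ρ ∈ σ) :
    |F.smoothH χ δ ρ (F.basePoint ε σ) - 2 * ε| ≤ K * δ := by
  have := F.abs_smoothH_sub_h_le hK hχ hδ ρ (F.basePoint ε σ)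
  rwa [basePoint, F.h_sum_of_mem_cones hσ (fun _ _ => by positivity) hρ] at this

theorem basePoint_mem_stFr (hK : ∀ ρ, LipschitzWith K (F.h ρ)) (hχ : IsRadialBump χ)
    (hδ : 0 < δ) (hε : 4 * (K * δ) ≤ ε) (hε' : 0 < ε) {σ : Finset ι} (hσ : σ ∈ F.cones) :
    F.basePoint ε σ ∈ F.stFr χ ε δ σ := fun ρ hρ => by
  linarith [(abs_le.1 (F.smoothH_basePoint hK hχ hδ hε' hσ hρ)).1]

theorem smoothH_proj (hK : ∀ ρ, LipschitzWith K (F.h ρ)) (hχ : IsRadialBump χ)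
    (hδ : 0 < δ) (hε : 4 * (K * δ) ≤ ε) (hε' : 0 < ε) {σ : Finset ι} (hσ : σ ∈ F.cones) {x : E}
    (hx : x ∈ F.stFr χ ε δ σ) {ρ : ι} (hρ : ρ ∈ σ) :
    F.smoothH χ δ ρ (F.proj χ ε δ σ x) = F.smoothH χ δ ρ x := by
  rw [proj, F.smoothH_add_sum hK hχ hδ hε hε' (F.basePoint_mem_stFr hK hχ hδ hε hε' hσ)
    (t := fun ρ => if ρ ∈ σ then
      F.smoothH χ δ ρ x - F.smoothH χ δ ρ (F.basePoint ε σ) else 0), if_pos hρ, add_sub_cancel]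
  · intro ρ hρ
    rw [if_pos hρ, add_sub_cancel]
    exact hx ρ hρ
  · exact fun ρ hρ => if_neg hρ

theorem proj_mem_coneFr (hK : ∀ ρ, LipschitzWith K (F.h ρ)) (hχ : IsRadialBump χ)
    (hδ : 0 < δ) (hε : 4 * (K * δ) ≤ ε) (hε' : 0 < ε) {σ : Finset ι} (hσ : σ ∈ F.cones) {x : E}
    (hx : x ∈ F.stFr χ ε δ σ) : F.proj χ ε δ σ x ∈ F.coneFr χ ε δ σ := by
  refine ⟨⟨_, fun ρ hρ => ?_, F.basePoint_add_sum fun ρ hρ => if_neg hρ⟩, fun ρ hρ => ?_⟩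
  · rw [if_pos hρ]
    -- The coefficient is at least `smoothH ρ x - K * δ`, which exceeds `ε - K * δ > 0`.
    have hx' := hx ρ hρ
    linarith [(abs_le.1 (F.smoothH_basePoint hK hχ hδ hε' hσ hρ)).2]
  · rw [F.smoothH_proj hK hχ hδ hε hε' hσ hx hρ]
    exact hx ρ hρ

/-- Points of `coneFr` differ from `basePoint` by a vector of `ℝσ`, whose coordinates are the
differences of the `smoothH` values. Hence these values determine the point. -/
theorem proj_eq_self (hK : ∀ ρ, LipschitzWith K (F.h ρ)) (hχ : IsRadialBump χ)
    (hδ : 0 < δ) (hε : 4 * (K * δ) ≤ ε) (hε' : 0 < ε) {σ : Finset ι} (hσ : σ ∈ F.cones) {b : E}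
    (hb : b ∈ F.coneFr χ ε δ σ) : F.proj χ ε δ σ b = b := by
  obtain ⟨⟨a, -, hba⟩, hb'⟩ := hb
  let t : ι → ℝ := fun ρ => if ρ ∈ σ then a ρ - 2 * ε else 0
  have ht : ∀ ρ ∉ σ, t ρ = 0 := fun ρ hρ => if_neg hρ
  have hbt : b = F.basePoint ε σ + ∑ ρ, t ρ • F.v ρ := by
    rw [F.basePoint_add_sum ht, hba]
    exact Finset.sum_congr rfl fun ρ hρ => by simp [t, hρ]
  have hH := F.smoothH_add_sum_of_mem hK hχ hδ hε hε' (F.basePoint_mem_stFr hK hχ hδ hε hε' hσ)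
    (t := t) (hbt ▸ hb') ht
  rw [← hbt] at hH
  conv_rhs => rw [hbt]
  rw [proj]
  congr 1
  refine Finset.sum_congr rfl fun ρ _ => ?_
  congr 1
  split_ifs with hρ
  · rw [hH, add_sub_cancel_left]
  · exact (ht ρ hρ).symm

theorem proj_congr {σ : Finset ι} {x y : E}
    (h : ∀ ρ ∈ σ, F.smoothH χ δ ρ x = F.smoothH χ δ ρ y) :
    F.proj χ ε δ σ x = F.proj χ ε δ σ y := by
  rw [proj, proj]
  congr 1
  refine Finset.sum_congr rfl fun ρ _ => ?_
  split_ifs with hρ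
  · rw [h ρ hρ]
  · rfl

theorem contDiff_proj (hK : ∀ ρ, LipschitzWith K (F.h ρ)) (hχ : IsRadialBump χ)
    (hδ : 0 < δ) (σ : Finset ι) : ContDiff ℝ ∞ (F.proj χ ε δ σ) := by
  refine contDiff_const.add (ContDiff.sum fun ρ _ => ContDiff.smul ?_ contDiff_const)
  split_ifs
  · exact (F.contDiff_smoothH hK hχ hδ ρ).sub contDiff_const
  · exact contDiff_const

theorem fibre_proj (hK : ∀ ρ, LipschitzWith K (F.h ρ)) (hχ : IsRadialBump χ)
    (hδ : 0 < δ) (hε : 4 * (K * δ) ≤ ε) (hε' : 0 < ε) {σ : Finset ι} (hσ : σ ∈ F.cones) {b : E}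
    (hb : b ∈ F.coneFr χ ε δ σ) :
    ProjectsDiffeomorphically (F.linearSpan σ) {x ∈ F.stFr χ ε δ σ | F.proj χ ε δ σ x = b} := by
  obtain ⟨l, hl⟩ := (F.linearSpan σ).mkQ.exists_rightInverse_of_surjective
    (LinearMap.range_eq_top.2 (F.linearSpan σ).mkQ_surjective)
  have hl' : ∀ y, (F.linearSpan σ).mkQ (l y) = y := fun y => LinearMap.congr_fun hl y
  have hlc : ContDiff ℝ ∞ l := (LinearMap.toContinuousLinearMap l).contDiff
  have hmk : ∀ t : ι → ℝ, (∀ ρ ∉ σ, t ρ = 0) →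
      (F.linearSpan σ).mkQ (∑ ρ, t ρ • F.v ρ) = 0 := by
    intro t ht
    rw [← LinearMap.mem_ker, Submodule.ker_mkQ]
    refine Submodule.sum_mem _ fun ρ _ => ?_
    by_cases hρ : ρ ∈ σ
    · exact Submodule.smul_mem _ _ (Submodule.subset_span ⟨ρ, hρ, rfl⟩)
    · simp [ht ρ hρ]
  -- Moving `x` by `S x` along every ray of `σ` brings it into `stFr`: `h` is then at least `S x - K
  -- * ‖x‖ ≥ 2 * ε`. The term `1 + ‖x‖ ^ 2` is a smooth majorant of `‖x‖`. The second displacement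
  -- `c` adjusts the coordinates to those of `b`; neither changes the class modulo `ℝσ`.
  let S : E → ℝ := fun x => 2 * ε + K * (1 + ‖x‖ ^ 2)
  let w : E → E := fun x => x + ∑ ρ, (if ρ ∈ σ then S x else 0) • F.v ρ
  let c : E → ι → ℝ := fun x ρ =>
    if ρ ∈ σ then F.smoothH χ δ ρ b - F.smoothH χ δ ρ (w x) else 0
  let s : E → E := fun x => w x + ∑ ρ, c x ρ • F.v ρ
  have hS : ContDiff ℝ ∞ S :=
    contDiff_const.add (contDiff_const.mul (contDiff_const.add (contDiff_norm_sq ℝ)))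
  have hw : ContDiff ℝ ∞ w := by
    refine contDiff_id.add (ContDiff.sum fun ρ _ => ContDiff.smul ?_ contDiff_const)
    split_ifs
    exacts [hS, contDiff_const]
  have hs : ContDiff ℝ ∞ s := by
    refine hw.add (ContDiff.sum fun ρ _ => ContDiff.smul ?_ contDiff_const)
    simp only [c]
    split_ifs
    exacts [contDiff_const.sub ((F.contDiff_smoothH hK hχ hδ ρ).comp hw), contDiff_const]
  have hwst : ∀ x, w x ∈ F.stFr χ ε δ σ := by
    intro x ρ hρ
    have h1 := (abs_le.1 (F.abs_smoothH_sub_h_le hK hχ hδ ρ (w x))).1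
    have h2 := (hK ρ).dist_le_mul (∑ ρ ∈ σ, S x • F.v ρ) (w x)
    have h3 : w x = x + ∑ ρ ∈ σ, S x • F.v ρ := by simp [w, ite_smul, Finset.sum_ite_mem]
    have h4 : (0 : ℝ) ≤ S x := by positivity
    rw [Real.dist_eq, F.h_sum_of_mem_cones hσ (fun _ _ => h4) hρ, h3,
      dist_eq_norm, sub_add_cancel_right, norm_neg, ← h3] at h2
    have h5 : (K : ℝ) * ‖x‖ ≤ K * (1 + ‖x‖ ^ 2) := by
      gcongr
      nlinarith [sq_nonneg (‖x‖ - 1)]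
    have h6 : S x = 2 * ε + K * (1 + ‖x‖ ^ 2) := rfl
    linarith [(abs_le.1 h2).2]
  have hc : ∀ x, ∀ ρ ∉ σ, c x ρ = 0 := fun x ρ hρ => if_neg hρ
  have hsH : ∀ x, ∀ ρ ∈ σ, F.smoothH χ δ ρ (s x) = F.smoothH χ δ ρ b := by
    intro x ρ hρ
    rw [F.smoothH_add_sum hK hχ hδ hε hε' (hwst x) (t := c x) (fun ρ hρ => ?_) (hc x)]
    · simp [c, hρ]
    · have := hb.2 ρ hρ
      simpa [c, hρ] using this
  have hsst : ∀ x, s x ∈ F.stFr χ ε δ σ := fun x ρ hρ => by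
    rw [hsH x ρ hρ]
    exact hb.2 ρ hρ
  have hsq : ∀ y, (F.linearSpan σ).mkQ (s (l y)) = y := by
    intro y
    rw [map_add, map_add, hmk _ (hc _), hmk _ fun ρ hρ => if_neg hρ, hl', add_zero, add_zero]
  refine ⟨fun y => s (l y), hs.comp hlc, fun y => ⟨hsst _, ?_⟩, hsq, fun x hx => ?_⟩
  · rw [F.proj_congr (hsH (l y)), F.proj_eq_self hK hχ hδ hε hε' hσ hb]
  · obtain ⟨hxst, hxb⟩ := hx
    set z := s (l ((F.linearSpan σ).mkQ x)) with hz
    have h1 : x - z ∈ F.linearSpan σ := by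
      rw [← Submodule.ker_mkQ (F.linearSpan σ), LinearMap.mem_ker, map_sub, hz, hsq, sub_self]
    obtain ⟨t, ht⟩ := (Submodule.mem_span_image_finset_iff_exists_fun' ℝ).1 h1
    let t' : ι → ℝ := fun ρ => if ρ ∈ σ then t ρ else 0
    have ht' : ∀ ρ ∉ σ, t' ρ = 0 := fun ρ hρ => if_neg hρ
    have hxz : x = z + ∑ ρ, t' ρ • F.v ρ := by
      have : ∑ ρ, t' ρ • F.v ρ = x - z := by
        rw [← ht]
        simp [t', ite_smul, Finset.sum_ite_mem]
      rw [this, add_sub_cancel]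
    have hH := F.smoothH_add_sum_of_mem hK hχ hδ hε hε' (hsst _) (t := t') (hxz ▸ hxst) ht'
    rw [← hz, ← hxz] at hH
    -- The points `x` and `z` have the same `smoothH` values on `σ`, and `t'` is the difference of
    -- these values.
    have h0 : ∀ ρ, t' ρ = 0 := by
      intro ρ
      by_cases hρ : ρ ∈ σ
      · have h2 := hH ρ
        rw [hsH _ ρ hρ, ← hxb, F.smoothH_proj hK hχ hδ hε hε' hσ hxst hρ] at h2
        linarith
      · exact ht' ρ hρ
    change z = x
    rw [hxz]
    simp only [h0, zero_smul, Finset.sum_const_zero, add_zero]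

theorem stFr_anti {σ τ : Finset ι} (h : σ ⊆ τ) : F.stFr χ ε δ τ ⊆ F.stFr χ ε δ σ :=
  fun _ hx ρ hρ => hx ρ (h hρ)

theorem isEquivariantCoherent_proj (hK : ∀ ρ, LipschitzWith K (F.h ρ)) (hχ : IsRadialBump χ)
    (hδ : 0 < δ) (hε : 4 * (K * δ) ≤ ε) (hε' : 0 < ε) (hr : IsSmoothedRamp ε r) :
    F.IsEquivariantCoherent χ r ε δ (F.proj χ ε δ) where
  mapsTo _ hσ _ _ hx := F.proj_mem_coneFr hK hχ hδ hε hε' hσ hx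
  smooth σ _ _ := (F.contDiff_proj hK hχ hδ σ).contDiffOn
  fibre _ hσ _ _ hb := F.fibre_proj hK hχ hδ hε hε' hσ hb
  coherent σ _ τ hτ _ hστ x hx :=
    ⟨F.stFr_anti hστ (F.proj_mem_coneFr hK hχ hδ hε hε' hτ hx).2, F.stFr_anti hστ hx,
      F.proj_congr fun _ hρ => F.smoothH_proj hK hχ hδ hε hε' hτ hx (hστ hρ)⟩
  equivariant σ hσ _ t ht := by
    obtain ⟨φ, hφ⟩ := hr.exists_isGlobalFlow
    rw [F.smoothAction_eq hK hχ hδ hε hε' hr hφ]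
    have hH := F.smoothH_explicitAction hK hχ hδ hε hε' hr hφ t
    have hst : Set.MapsTo (F.explicitAction χ δ φ t) (F.stFr χ ε δ σ) (F.stFr χ ε δ σ) := by
      intro x hx ρ hρ
      rw [hH]
      exact hr.lt_flow hφ (hx ρ hρ) _
    have hcone : Set.MapsTo (F.explicitAction χ δ φ t) (F.coneFr χ ε δ σ) (F.coneFr χ ε δ σ) := by
      refine fun b hb => ⟨?_, hst hb.2⟩
      obtain ⟨a, ha, hba⟩ := hb.1
      -- Positivity: `a ρ` equals `h ρ b`, within `K * δ` of `smoothH ρ b`, while the value of `φ`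
      -- exceeds `ε`.
      refine ⟨fun ρ => a ρ + (φ (t ρ) (F.smoothH χ δ ρ b) - F.smoothH χ δ ρ b), fun ρ hρ => ?_, ?_⟩
      · have h1 := F.abs_smoothH_sub_h_le hK hχ hδ ρ b
        have h2 : F.h ρ b = a ρ := by
          rw [hba, F.h_sum_of_mem_cones hσ (fun ρ hρ => (ha ρ hρ).le) hρ]
        have h3 := hr.lt_flow hφ (hb.2 ρ hρ) (t ρ)
        rw [h2] at h1
        linarith [(abs_le.1 h1).2]
      · simp only [add_smul, Finset.sum_add_distrib]
        rw [← hba, explicitAction, ← Finset.sum_subset (Finset.subset_univ σ) fun ρ _ hρ => by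
          rw [ht ρ hρ, (hφ _).1, sub_self, zero_smul]]
    refine ⟨hst, hcone, fun x hx => ?_⟩
    have hpx := F.proj_mem_coneFr hK hχ hδ hε hε' hσ hx
    -- The right-hand side lies in `coneFr`, hence equals its own projection; it remains to compare
    -- `smoothH` values on `σ`.
    rw [← F.proj_eq_self hK hχ hδ hε hε' hσ (hcone hpx)]
    exact F.proj_congr fun ρ hρ => by
      rw [hH, hH, F.smoothH_proj hK hχ hδ hε hε' hσ hx hρ]

end Smoothing

end CompleteSimplicialFan

/-! ### The main theorem -/

theorem mainTheorem12 {ι E : Type*} [Fintype ι] [DecidableEq ι]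
    [NormedAddCommGroup E] [InnerProductSpace ℝ E] [FiniteDimensional ℝ E]
    [MeasurableSpace E] [BorelSpace E] (F : CompleteSimplicialFan ι E) :
    ∃ c : ℝ, 0 < c ∧ ∀ ε δ : ℝ, 0 < ε → 0 < δ → δ ≤ c * ε →
      ∀ χ : E → ℝ, IsRadialBump χ → ∀ r : ℝ → ℝ, IsSmoothedRamp ε r →
        (∀ ρ, IsGlobalFlow (F.smoothField χ r δ ρ) (F.smoothFlow χ r δ ρ)) ∧
        (∀ ρ ρ' s s', Function.Commute (F.smoothFlow χ r δ ρ s) (F.smoothFlow χ r δ ρ' s')) ∧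
        (∀ t t' : ι → ℝ, F.smoothAction χ r δ (t + t') =
          F.smoothAction χ r δ t ∘ F.smoothAction χ r δ t') ∧
        ∃ π : Finset ι → E → E, F.IsEquivariantCoherent χ r ε δ π := by
  obtain ⟨K, hK⟩ := F.exists_lipschitzWith_h
  -- This constant yields `4 * (K * δ) ≤ ε`; the summand `1` avoids division by zero when `K = 0`.
  refine ⟨1 / (4 * (K + 1)), by positivity, fun ε δ hε' hδ hδε χ hχ r hr => ?_⟩
  have hε : 4 * (K * δ) ≤ ε := by
    rw [one_div, ← div_eq_inv_mul, le_div_iff₀ (by positivity)] at hδε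
    linarith
  obtain ⟨φ, hφ⟩ := hr.exists_isGlobalFlow
  refine ⟨F.isGlobalFlow_smoothFlow hK hχ hδ hε hε' hr, fun ρ ρ' s s' x => ?_, fun t t' => ?_,
    _, F.isEquivariantCoherent_proj hK hχ hδ hε hε' hr⟩
  · have hadd := F.explicitAction_add hK hχ hδ hε hε' hr hφ
    simp only [F.smoothFlow_eq hK hχ hδ hε hε' hr hφ]
    rw [← Function.comp_apply (f := F.explicitAction χ δ φ _), ← hadd, add_comm, hadd,
      Function.comp_apply]
  · simp only [F.smoothAction_eq hK hχ hδ hε hε' hr hφ,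
      F.explicitAction_add hK hχ hδ hε hε' hr hφ]
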